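/- Let $G=(V,E)$ be a finite directed tree, i.e. an orientation of a finite undirected tree, and let $S\subseteq V$ be a set of sources and $R\subseteq V$ a set of receivers. Fix a field $F$ and nonzero coefficients $c_{uv}\in F$, one for each link $uv\in E$ (bitwise XOR coding is the case $F=\mathbb F_2$, $c_{uv}=1$). In an experiment each link $e$ works with probability $\alpha_e\in(0,1]$, independently of the other links. Each source $i\in S$ injects the unit vector $x_i\in F^{S}$, and each node adds up the packets arriving on its working incoming links (and its own probe, if it is a source), the packet arriving on $uv$ being multiplied by $c_{uv}$, and multicasts the result on all its outgoing links: the packet at $v$ is $$X_v=\mathbf 1[v\in S]\,x_v+\sum_{uv\in E,\ uv\text{ works}}c_{uv}X_u .$$ Let $P_\alpha$ be the distribution of the observation $(X_r)_{r\in R}\in (F^{S})^{R}$, for $\alpha=(\alpha_e)_{e\in E}$. A link $e$ is called identifiable if for all $\alpha,\alpha'\in(0,1]^{E}$, $P_\alpha=P_{\alpha'}$ implies $\alpha_e=\alpha'_e$. Theorem. A link $CD\in E$ is identifiable if and only if both of the following conditions hold (paths are directed; a path may consist of a single vertex). Condition 1. At least one of the following holds: (a) $C\in S$; (b) there are distinct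 $X_1,X_2\in S$ and edge-disjoint paths from $X_1$ to $C$ and from $X_2$ to $C$ that do not use the link $CD$; (c) there are $X_1\in S$, $X_2\in R$ and paths from $X_1$ to $C$ and from $C$ to $X_2$ that do not use $CD$. Condition 2. At least one of the following holds: (a) $D\in R$; (b) there are distinct $X_1,X_2\in R$ and edge-disjoint paths from $D$ to $X_1$ and from $D$ to $X_2$ that do not use the link $CD$; (c) there are $X_1\in S$, $X_2\in R$ and paths from $X_1$ to $D$ and from $D$ to $X_2$ that do not use $CD$. -/

import Mathlib

namespace LossTomography

/-- A directed tree: an orientation of a tree (no self-loops, no pair of opposite links, and the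
underlying undirected graph is connected and acyclic). -/
structure IsDirectedTree {V : Type*} (G : Digraph V) : Prop where
  asymm : ∀ u v : V, G.Adj u v → ¬ G.Adj v u
  isTree : G.toSimpleGraphInclusive.IsTree

/-- A nontrivial directed walk, viewed in the underlying graph, with all its darts oriented. -/
theorem IsDirectedTree.exists_walk {V : Type*} {G : Digraph V} (hG : IsDirectedTree G) {u v : V}
    (h : Relation.TransGen G.Adj u v) :
    ∃ p : G.toSimpleGraphInclusive.Walk u v, ¬ p.Nil ∧
      List.IsChain (fun a b : G.toSimpleGraphInclusive.Dart => a.snd = b.fst) p.darts ∧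
      ∀ d ∈ p.darts, G.Adj d.fst d.snd := by
  have adj : ∀ {a b : V}, G.Adj a b → G.toSimpleGraphInclusive.Adj a b := fun {a b} hab =>
    ⟨fun e => by subst e; exact hG.asymm _ _ hab hab, Or.inl hab⟩
  induction h using Relation.TransGen.head_induction_on with
  | single h =>
    exact ⟨SimpleGraph.Walk.cons (adj h) SimpleGraph.Walk.nil, by simp, by simp, by simpa using h⟩
  | head h _ ih =>
    obtain ⟨p, _, _, hp⟩ := ih
    refine ⟨SimpleGraph.Walk.cons (adj h) p, by simp, SimpleGraph.Walk.isChain_dartAdj_darts _, ?_⟩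
    intro d hd
    rw [SimpleGraph.Walk.darts_cons, List.mem_cons] at hd
    rcases hd with rfl | hd
    · exact h
    · exact hp d hd

/-- Following the links of a finite directed tree backwards always terminates. -/
theorem IsDirectedTree.wellFounded {V : Type*} [Finite V] {G : Digraph V}
    (hG : IsDirectedTree G) : WellFounded G.Adj := by
  have irrefl : ∀ u : V, ¬ Relation.TransGen G.Adj u u := by
    intro u h
    obtain ⟨p, hp, hc, hd⟩ := hG.exists_walk h
    have hpath : p.IsPath := by
      rw [hG.isTree.isAcyclic.isPath_iff_isChain, SimpleGraph.Walk.edges, List.isChain_map]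
      rw [List.isChain_iff_getElem] at hc ⊢
      intro i hi heq
      have h1 := hc i hi
      have a1 := hd _ (List.getElem_mem (l := p.darts) (n := i) (by omega))
      have a2 := hd _ (List.getElem_mem (l := p.darts) (n := i + 1) hi)
      rw [SimpleGraph.dart_edge_eq_iff] at heq
      rcases heq with heq | heq
      · rw [← heq] at h1
        rw [h1] at a1
        exact hG.asymm _ _ a1 a1
      · rw [heq] at a1
        exact hG.asymm _ _ a2 a1
    rw [SimpleGraph.Walk.isPath_iff_nil] at hpath
    exact hp hpath
  have : Std.Irrefl (Relation.TransGen G.Adj) := ⟨irrefl⟩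
  have wf : WellFounded (Relation.TransGen G.Adj) := Finite.wellFounded_of_trans_of_irrefl _
  exact Subrelation.wf (fun h => Relation.TransGen.single h) wf

/-- The links of the network. -/
abbrev Link {V : Type*} (G : Digraph V) : Type _ := {e : V × V // G.Adj e.1 e.2}

/-- The packet present at each node when `W` tells which links work, as the vector of its symbols
indexed by the sources; `0` means that no packet is present. Source `i` injects the `i`-th unit
vector, and every node adds up the packets that arrive on its incoming links, the packet on the
link `uv` being scaled by `c u v`, and multicasts the result on all its outgoing links. -/
noncomputable def packet {V F : Type*} [Fintype V] [DecidableEq V] [Field F]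
    (G : Digraph V) [DecidableRel G.Adj] (hG : IsDirectedTree G) (S : Finset V)
    (c : V → V → F) (W : Link G → Bool) : V → (S → F) :=
  hG.wellFounded.fix fun v X i =>
    (if (i : V) = v then 1 else 0) +
      ∑ u : {u : V // G.Adj u v}, if W ⟨(u, v), u.2⟩ then c u v * X u u.2 i else 0

theorem packet_eq {V F : Type*} [Fintype V] [DecidableEq V] [Field F]
    (G : Digraph V) [DecidableRel G.Adj] (hG : IsDirectedTree G) (S : Finset V)
    (c : V → V → F) (W : Link G → Bool) (v : V) (i : S) :
    packet G hG S c W v i = (if (i : V) = v then 1 else 0) +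
      ∑ u : {u : V // G.Adj u v}, if W ⟨(u, v), u.2⟩ then c u v * packet G hG S c W u i else 0 := by
  unfold packet
  rw [WellFounded.fix_eq]

/-- The packets collected at the receivers. -/
noncomputable def observation {V F : Type*} [Fintype V] [DecidableEq V] [Field F]
    (G : Digraph V) [DecidableRel G.Adj] (hG : IsDirectedTree G) (S R : Finset V)
    (c : V → V → F) (W : Link G → Bool) : R → S → F :=
  fun r => packet G hG S c W r

/-- The probability that exactly the links `e` with `W e = true` work, when the links work
independently, link `e` with probability `α e`. -/
def stateProb {V : Type*} [Fintype V] (G : Digraph V) [DecidableRel G.Adj]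
    (α : Link G → ℝ) (W : Link G → Bool) : ℝ :=
  ∏ e : Link G, if W e then α e else 1 - α e

/-- The distribution of the observations, as a probability mass function. -/
noncomputable def obsProb {V F : Type*} [Fintype V] [DecidableEq V] [Field F] [DecidableEq F]
    (G : Digraph V) [DecidableRel G.Adj] (hG : IsDirectedTree G) (S R : Finset V)
    (c : V → V → F) (α : Link G → ℝ) (x : R → S → F) : ℝ :=
  ∑ W : Link G → Bool, if observation G hG S R c W = x then stateProb G α W else 0

/-- The link `e` is identifiable: the distribution of the observations determines its success
probability, all success probabilities being in `(0, 1]`. -/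
def IsIdentifiable {V F : Type*} [Fintype V] [DecidableEq V] [Field F] [DecidableEq F]
    (G : Digraph V) [DecidableRel G.Adj] (hG : IsDirectedTree G) (S R : Finset V)
    (c : V → V → F) (e : Link G) : Prop :=
  ∀ α α' : Link G → ℝ, (∀ l, α l ∈ Set.Ioc (0 : ℝ) 1) → (∀ l, α' l ∈ Set.Ioc (0 : ℝ) 1) →
    obsProb G hG S R c α = obsProb G hG S R c α' → α e = α' e

/-- `p` lists the vertices of a directed path from `u` to `v` (of one vertex if `u = v`). -/
structure IsDiPath {V : Type*} (G : Digraph V) (u v : V) (p : List V) : Prop where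
  chain : p.IsChain G.Adj
  nodup : p.Nodup
  head : p.head? = some u
  last : p.getLast? = some v

/-- The ordered pairs of consecutive vertices of a list, that is, the links of a path. -/
def pathLinks {V : Type*} (p : List V) : List (V × V) := p.zip p.tail

/-- The condition on the tail `C` of the link `CD`. -/
def TailCondition {V : Type*} (G : Digraph V) (S R : Finset V) (C D : V) : Prop :=
  C ∈ S ∨
  (∃ X₁ ∈ S, ∃ X₂ ∈ S, X₁ ≠ X₂ ∧ ∃ p₁ p₂ : List V, IsDiPath G X₁ C p₁ ∧ IsDiPath G X₂ C p₂ ∧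
    (pathLinks p₁).Disjoint (pathLinks p₂) ∧ (C, D) ∉ pathLinks p₁ ∧ (C, D) ∉ pathLinks p₂) ∨
  (∃ X₁ ∈ S, ∃ X₂ ∈ R, ∃ p₁ p₂ : List V, IsDiPath G X₁ C p₁ ∧ IsDiPath G C X₂ p₂ ∧
    (C, D) ∉ pathLinks p₁ ∧ (C, D) ∉ pathLinks p₂)

/-- The condition on the head `D` of the link `CD`. -/
def HeadCondition {V : Type*} (G : Digraph V) (S R : Finset V) (C D : V) : Prop :=
  D ∈ R ∨
  (∃ X₁ ∈ R, ∃ X₂ ∈ R, X₁ ≠ X₂ ∧ ∃ p₁ p₂ : List V, IsDiPath G D X₁ p₁ ∧ IsDiPath G D X₂ p₂ ∧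
    (pathLinks p₁).Disjoint (pathLinks p₂) ∧ (C, D) ∉ pathLinks p₁ ∧ (C, D) ∉ pathLinks p₂) ∨
  (∃ X₁ ∈ S, ∃ X₂ ∈ R, ∃ p₁ p₂ : List V, IsDiPath G X₁ D p₁ ∧ IsDiPath G D X₂ p₂ ∧
    (C, D) ∉ pathLinks p₁ ∧ (C, D) ∉ pathLinks p₂)

end LossTomography

/-!
The symbol of the source `s` at the receiver `r` is a fixed nonzero scalar if all links of the path
from `s` to `r` work, and zero otherwise. Hence the indicator of an observation is a polynomial in
the indicators of the events that such a path works, and the law of the observation carries the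
same information as the products of the success probabilities over all unions of such paths.

Every link `e` of a tree is a bridge; let `U` be its head side. If the condition on the tail of `e`
holds, the common factor coming from the links before the tail can be divided out, by
inclusion-exclusion over two disjoint paths into the tail or with the help of a path that leaves
through the tail. Thus the tail acts as an additional source for the receivers in `U`. Repeating
this with all links reversed makes the head of `e` an additional receiver, and isolates `e`.
Conversely, if the condition on the tail fails, either no path uses `e`, or `e` is used by exactly
the same paths as the link entering its tail, so that one half as success probability of the one
cannot be told from one half as success probability of the other.
-/

namespace LossTomography

open Relation

/-- A directed multigraph given by the end points of its edges. It replaces `Digraph` in the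
combinatorial part because the edge type, and with it every set of links, stays the same when the
orientation is reversed. -/
structure Multidigraph (V E : Type*) where
  tail : E → V
  head : E → V

namespace Multidigraph

variable {V E : Type*} (N : Multidigraph V E)

/-- The multigraph with all edges turned around. -/
def reverse : Multidigraph V E := ⟨N.head, N.tail⟩

/-- The reachability relation: there is a directed path, possibly of length zero. -/
def Reaches : V → V → Prop := ReflTransGen fun u v => ∃ e, N.tail e = u ∧ N.head e = v

/-- The set `U` is the head side of the bridge `e`: the edge `e` enters `U`, and no other edge
joins `U` to its complement. -/
structure IsCut (e : E) (U : Set V) : Prop where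
  tail_notMem : N.tail e ∉ U
  head_mem : N.head e ∈ U
  tail_mem_iff : ∀ ⦃e'⦄, e' ≠ e → (N.tail e' ∈ U ↔ N.head e' ∈ U)

/-- A multigraph whose underlying undirected graph is a forest, in the form: every edge is a
bridge. -/
def IsForest : Prop := ∀ e, ∃ U, N.IsCut e U

variable {N} {e e' : E} {U : Set V} {u v w : V}

theorem reaches_reverse : N.reverse.Reaches u v ↔ N.Reaches v u := by
  rw [Reaches, Reaches, ← reflTransGen_swap]
  simp only [reverse, and_comm]

theorem reaches_tail_head (e : E) : N.Reaches (N.tail e) (N.head e) := .single ⟨e, rfl, rfl⟩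

theorem Reaches.trans (huv : N.Reaches u v) (hvw : N.Reaches v w) : N.Reaches u w :=
  ReflTransGen.trans huv hvw

theorem Reaches.eq_or_exists_last (h : N.Reaches u v) :
    u = v ∨ ∃ e, N.Reaches u (N.tail e) ∧ N.head e = v := by
  rcases ReflTransGen.cases_tail h with rfl | ⟨_, hu, e, rfl, rfl⟩
  exacts [.inl rfl, .inr ⟨e, hu, rfl⟩]

namespace IsCut

theorem compl (hU : N.IsCut e U) : N.reverse.IsCut e Uᶜ where
  tail_notMem := not_not_intro hU.head_mem
  head_mem := hU.tail_notMem
  tail_mem_iff _ he' := not_congr (hU.tail_mem_iff he').symm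

theorem head_mem_of_tail_mem (hU : N.IsCut e U) (h : N.tail e' ∈ U) : N.head e' ∈ U := by
  by_cases he' : e' = e
  · exact he' ▸ hU.head_mem
  · exact (hU.tail_mem_iff he').mp h

theorem mem_of_reaches (hU : N.IsCut e U) (huv : N.Reaches u v) (hu : u ∈ U) : v ∈ U := by
  induction huv with
  | refl => exact hu
  | tail _ hvw ih =>
    obtain ⟨e', rfl, rfl⟩ := hvw
    exact hU.head_mem_of_tail_mem ih

theorem not_reaches (hU : N.IsCut e U) : ¬ N.Reaches (N.head e) (N.tail e) := fun h =>
  hU.tail_notMem (hU.mem_of_reaches h hU.head_mem)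

theorem reaches_of_notMem_of_mem (hU : N.IsCut e U) (huv : N.Reaches u v) (hu : u ∉ U)
    (hv : v ∈ U) : N.Reaches u (N.tail e) ∧ N.Reaches (N.head e) v := by
  induction huv with
  | refl => exact absurd hv hu
  | @tail x w hux hxw ih =>
    obtain ⟨e', rfl, rfl⟩ := hxw
    by_cases he' : e' = e
    · exact he' ▸ ⟨hux, .refl⟩
    · obtain ⟨htail, hhead⟩ := ih ((hU.tail_mem_iff he').mpr hv)
      exact ⟨htail, hhead.trans (reaches_tail_head e')⟩

end IsCut

theorem IsForest.reverse (hN : N.IsForest) : N.reverse.IsForest := fun e =>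
  let ⟨_, hU⟩ := hN e
  ⟨_, hU.compl⟩

theorem IsForest.not_reaches (hN : N.IsForest) (e : E) : ¬ N.Reaches (N.head e) (N.tail e) :=
  let ⟨_, hU⟩ := hN e
  hU.not_reaches

theorem IsForest.eq_of_head_eq (hN : N.IsForest) (he : N.Reaches u (N.tail e))
    (he' : N.Reaches u (N.tail e')) (hhead : N.head e' = N.head e) : e' = e := by
  by_contra hne
  obtain ⟨U, hU⟩ := hN e
  have hu : u ∉ U := fun h => hU.tail_notMem (hU.mem_of_reaches he h)
  have htail : N.tail e' ∈ U := (hU.tail_mem_iff hne).mpr (hhead ▸ hU.head_mem)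
  exact hN.not_reaches e' (hhead ▸ (hU.reaches_of_notMem_of_mem he' hu htail).2)

section LinksBetween

variable [Fintype E] {S R : Set V}

open scoped Classical in
/-- The edges that lie on some directed path from `u` to `v`. In a forest these are the edges of
the unique path from `u` to `v`, if there is one. -/
noncomputable def linksBetween (N : Multidigraph V E) (u v : V) : Finset E :=
  {e | N.Reaches u (N.tail e) ∧ N.Reaches (N.head e) v}

@[simp]
theorem mem_linksBetween :
    e ∈ N.linksBetween u v ↔ N.Reaches u (N.tail e) ∧ N.Reaches (N.head e) v := by
  simp [linksBetween]

theorem linksBetween_reverse (u v : V) : N.reverse.linksBetween u v = N.linksBetween v u := by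
  ext e
  simp only [mem_linksBetween, reaches_reverse]
  exact and_comm

theorem IsCut.mem_linksBetween_iff (hU : N.IsCut e U) (huv : N.Reaches u v) :
    e ∈ N.linksBetween u v ↔ u ∉ U ∧ v ∈ U := by
  rw [mem_linksBetween]
  refine ⟨fun ⟨hu, hv⟩ => ⟨fun hmem => hU.tail_notMem (hU.mem_of_reaches hu hmem),
    hU.mem_of_reaches hv hU.head_mem⟩, fun ⟨hu, hv⟩ => hU.reaches_of_notMem_of_mem huv hu hv⟩

namespace IsForest

theorem linksBetween_self (hN : N.IsForest) (u : V) : N.linksBetween u u = ∅ :=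
  Finset.eq_empty_of_forall_notMem fun e he =>
    have ⟨htail, hhead⟩ := mem_linksBetween.mp he
    hN.not_reaches e (hhead.trans htail)

theorem linksBetween_tail_head (hN : N.IsForest) (e : E) :
    N.linksBetween (N.tail e) (N.head e) = {e} := by
  ext e'
  obtain ⟨U, hU⟩ := hN e'
  rw [hU.mem_linksBetween_iff (reaches_tail_head e), Finset.mem_singleton]
  refine ⟨fun ⟨htail, hhead⟩ => ?_, ?_⟩
  · by_contra hne
    exact htail ((hU.tail_mem_iff (Ne.symm hne)).mpr hhead)
  · rintro rfl
    exact ⟨hU.tail_notMem, hU.head_mem⟩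

theorem linksBetween_union [DecidableEq E] (hN : N.IsForest) (huv : N.Reaches u v)
    (hvw : N.Reaches v w) :
    N.linksBetween u v ∪ N.linksBetween v w = N.linksBetween u w := by
  ext e
  obtain ⟨U, hU⟩ := hN e
  rw [Finset.mem_union, hU.mem_linksBetween_iff huv, hU.mem_linksBetween_iff hvw,
    hU.mem_linksBetween_iff (huv.trans hvw)]
  have := hU.mem_of_reaches huv
  have := hU.mem_of_reaches hvw
  tauto

theorem insert_linksBetween_head [DecidableEq E] (hN : N.IsForest) (hv : N.Reaches (N.head e) v) :
    insert e (N.linksBetween (N.head e) v) = N.linksBetween (N.tail e) v := by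
  rw [← hN.linksBetween_union (reaches_tail_head e) hv, hN.linksBetween_tail_head,
    Finset.insert_eq]

theorem insert_linksBetween_tail [DecidableEq E] (hN : N.IsForest) (hu : N.Reaches u (N.tail e)) :
    insert e (N.linksBetween u (N.tail e)) = N.linksBetween u (N.head e) := by
  rw [← hN.linksBetween_union hu (reaches_tail_head e), hN.linksBetween_tail_head,
    Finset.union_comm, Finset.insert_eq]

theorem reaches_tail_of_mem_linksBetween (hN : N.IsForest) {l : E}
    (hu : N.Reaches u (N.tail e)) (hlu : l ∈ N.linksBetween u (N.head e))
    (hlv : l ∈ N.linksBetween v (N.head e)) : N.Reaches v (N.tail e) := by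
  obtain ⟨U, hU⟩ := hN e
  rw [mem_linksBetween] at hlu hlv
  have huU : u ∉ U := fun h => hU.tail_notMem (hU.mem_of_reaches hu h)
  have hvU : v ∉ U := fun h =>
    have htail := hU.mem_of_reaches hlv.1 h
    have hcross := (hU.reaches_of_notMem_of_mem hlu.1 huU htail).2
    hN.not_reaches l (hlu.2.trans hcross)
  have hve := (hlv.1.trans (reaches_tail_head l)).trans hlv.2
  exact (hU.reaches_of_notMem_of_mem hve hvU hU.head_mem).1

end IsForest

theorem IsCut.head_mem_of_mem_linksBetween (hU : N.IsCut e U) (hN : N.IsForest)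
    {s r : V} (hs : s = N.tail e ∨ s ∈ U) (hr : r ∈ U) {l : E}
    (hl : l ∈ N.linksBetween s r) : N.head l ∈ U := by
  obtain ⟨hsl, hlr⟩ := mem_linksBetween.mp hl
  by_contra hlU
  rcases hs with rfl | hs
  · exact hN.not_reaches l ((hU.reaches_of_notMem_of_mem hlr hlU hr).1.trans hsl)
  · exact hlU (hU.head_mem_of_tail_mem (hU.mem_of_reaches hsl hs))

/-- The link sets of the paths from a vertex of `S` to a vertex of `R`. -/
def pathLinkSets (N : Multidigraph V E) (S R : Set V) : Set (Finset E) :=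
  {M | ∃ s ∈ S, ∃ r ∈ R, N.Reaches s r ∧ N.linksBetween s r = M}

theorem pathLinkSets_reverse (S R : Set V) :
    N.reverse.pathLinkSets R S = N.pathLinkSets S R := by
  ext M
  simp only [pathLinkSets, reaches_reverse, linksBetween_reverse, Set.mem_ofPred_eq]
  exact ⟨fun ⟨r, hr, s, hs, h⟩ => ⟨s, hs, r, hr, h⟩, fun ⟨s, hs, r, hr, h⟩ => ⟨r, hr, s, hs, h⟩⟩

/-- The condition on the tail of the link `e` in terms of reachability. The first alternative
allows `s = s'`, which covers a source at the tail: `linksBetween s s'` is empty for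
`s = s' = N.tail e`. The condition on the head is this one for `N.reverse`. -/
def TailResolvable (N : Multidigraph V E) (S R : Set V) (e : E) : Prop :=
  (∃ s ∈ S, ∃ s' ∈ S, N.Reaches s (N.tail e) ∧ N.Reaches s' (N.tail e) ∧
    Disjoint (N.linksBetween s (N.tail e)) (N.linksBetween s' (N.tail e))) ∨
  ∃ s ∈ S, ∃ r ∈ R, N.Reaches s (N.tail e) ∧ N.Reaches (N.tail e) r ∧ ¬ N.Reaches (N.head e) r

theorem IsCut.tailResolvable_reverse_inter (hU : N.IsCut e U)
    (h : N.reverse.TailResolvable R S e) :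
    N.reverse.TailResolvable (R ∩ U) (insert (N.tail e) (S ∩ U)) e := by
  simp only [TailResolvable, reaches_reverse] at h ⊢
  rcases h with ⟨r, hr, r', hr', her, her', hdisj⟩ | ⟨r, hr, s, hs, her, hse, hnot⟩
  · exact .inl ⟨r, ⟨hr, hU.mem_of_reaches her hU.head_mem⟩,
      r', ⟨hr', hU.mem_of_reaches her' hU.head_mem⟩, her, her', hdisj⟩
  · have hsU : s ∈ U := by
      by_contra hsU
      exact hnot (hU.reaches_of_notMem_of_mem hse hsU hU.head_mem).1
    exact .inr ⟨r, ⟨hr, hU.mem_of_reaches her hU.head_mem⟩, s, .inr ⟨hs, hsU⟩, her, hse, hnot⟩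

theorem IsForest.tailResolvable_iff (hN : N.IsForest) :
    N.TailResolvable S R e ↔ N.tail e ∈ S ∨
      (∃ s ∈ S, ∃ s' ∈ S, s ≠ s' ∧ N.Reaches s (N.tail e) ∧ N.Reaches s' (N.tail e) ∧
        Disjoint (N.linksBetween s (N.tail e)) (N.linksBetween s' (N.tail e))) ∨
      ∃ s ∈ S, ∃ r ∈ R, N.Reaches s (N.tail e) ∧ N.Reaches (N.tail e) r ∧
        ¬ N.Reaches (N.head e) r := by
  rw [← or_assoc]
  refine or_congr ⟨?_, ?_⟩ Iff.rfl
  · rintro ⟨s, hs, s', hs', hse, hs'e, hdisj⟩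
    rcases eq_or_ne s s' with rfl | hne
    · have hnone : N.linksBetween s (N.tail e) = ∅ := disjoint_self.mp hdisj
      rcases hse.eq_or_exists_last with rfl | ⟨l, hsl, hle⟩
      · exact .inl hs
      · exact absurd (mem_linksBetween.mpr ⟨hsl, hle ▸ .refl⟩) (hnone ▸ Finset.notMem_empty l)
    · exact .inr ⟨s, hs, s', hs', hne, hse, hs'e, hdisj⟩
  · rintro (hS | ⟨s, hs, s', hs', -, h⟩)
    · exact ⟨_, hS, _, hS, .refl, .refl, disjoint_self.mpr (hN.linksBetween_self _)⟩
    · exact ⟨s, hs, s', hs', h⟩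

end LinksBetween

end Multidigraph

section Determines

variable {E : Type*} [DecidableEq E] {𝓟 : Set (Finset E)} {e e' : E} {α α' : E → ℝ}

/-- The success probability of the link `e` is a function of the probabilities that all links of a
union of members of `𝓟` work. -/
def Determines (𝓟 : Set (Finset E)) (e : E) : Prop :=
  ∀ α α' : E → ℝ, (∀ l, α l ∈ Set.Ioc (0 : ℝ) 1) → (∀ l, α' l ∈ Set.Ioc (0 : ℝ) 1) →
    (∀ M ∈ supClosure 𝓟, ∏ l ∈ M, α l = ∏ l ∈ M, α' l) → α e = α' e

theorem mulSingle_one_half_mem_Ioc (e l : E) :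
    (Pi.mulSingle e (1 / 2) : E → ℝ) l ∈ Set.Ioc (0 : ℝ) 1 := by
  rw [Pi.mulSingle_apply]
  split_ifs <;> norm_num

theorem Determines.exists_mem (h : Determines 𝓟 e) : ∃ M ∈ 𝓟, e ∈ M := by
  by_contra! hunused
  have hclosure : supClosure 𝓟 ⊆ {M | e ∉ M} :=
    supClosure_min hunused fun M hM N hN => by simp_all
  have hhalf := h (Pi.mulSingle e (1 / 2)) 1 (mulSingle_one_half_mem_Ioc e) (by simp)
    fun M hM => by simp [Finset.prod_pi_mulSingle', show e ∉ M from hclosure hM]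
  norm_num at hhalf

theorem Determines.eq_of_forall_mem_iff (h : Determines 𝓟 e) (htwin : ∀ M ∈ 𝓟, e ∈ M ↔ e' ∈ M) :
    e' = e := by
  by_contra hne
  have hclosure : supClosure 𝓟 ⊆ {M | e ∈ M ↔ e' ∈ M} :=
    supClosure_min htwin fun M hM N hN => by simp_all
  have hhalf := h (Pi.mulSingle e (1 / 2)) (Pi.mulSingle e' (1 / 2))
    (mulSingle_one_half_mem_Ioc e) (mulSingle_one_half_mem_Ioc e')
    fun M hM => by simp [Finset.prod_pi_mulSingle', show e ∈ M ↔ e' ∈ M from hclosure hM]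
  rw [Pi.mulSingle_eq_same, Pi.mulSingle_eq_of_ne (Ne.symm hne)] at hhalf
  norm_num at hhalf

theorem prod_inter_eq (hα' : ∀ l, α' l ≠ 0) {M N : Finset E}
    (hM : ∏ l ∈ M, α l = ∏ l ∈ M, α' l) (hN : ∏ l ∈ N, α l = ∏ l ∈ N, α' l)
    (hMN : ∏ l ∈ M ∪ N, α l = ∏ l ∈ M ∪ N, α' l) : ∏ l ∈ M ∩ N, α l = ∏ l ∈ M ∩ N, α' l := by
  have h := Finset.prod_union_inter (s₁ := M) (s₂ := N) (f := α)
  rw [hM, hN, hMN, ← Finset.prod_union_inter] at h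
  exact mul_left_cancel₀ (Finset.prod_ne_zero_iff.mpr fun l _ => hα' l) h

theorem prod_eq_of_disjoint (hα' : ∀ l, α' l ≠ 0) {M N : Finset E} (hdisj : Disjoint M N)
    (hN : ∏ l ∈ N, α l = ∏ l ∈ N, α' l) (hMN : ∏ l ∈ M ∪ N, α l = ∏ l ∈ M ∪ N, α' l) :
    ∏ l ∈ M, α l = ∏ l ∈ M, α' l := by
  rw [Finset.prod_union hdisj, Finset.prod_union hdisj, hN] at hMN
  exact mul_right_cancel₀ (Finset.prod_ne_zero_iff.mpr fun l _ => hα' l) hMN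

end Determines

namespace Multidigraph

variable {V E : Type*} [Fintype E] [DecidableEq E] {N : Multidigraph V E} {S R : Set V} {e : E}
  {U : Set V}

-- If the condition fails, `e` is used together with the link entering its tail, or not at all.
theorem tailResolvable_of_determines (hN : N.IsForest)
    (h : Determines (N.pathLinkSets S R) e) : N.TailResolvable S R e := by
  by_contra hres
  obtain ⟨hdisj, hescape⟩ := not_or.mp hres
  push Not at hdisj hescape
  obtain ⟨_, ⟨s₀, hs₀, r₀, -, -, rfl⟩, he₀⟩ := h.exists_mem
  obtain ⟨hs₀e, -⟩ := mem_linksBetween.mp he₀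
  have hshared : ∀ s ∈ S, N.Reaches s (N.tail e) →
      ∃ l ∈ N.linksBetween s₀ (N.tail e), l ∈ N.linksBetween s (N.tail e) :=
    fun s hs hse => Finset.not_disjoint_iff.mp (hdisj s₀ hs₀ s hs hs₀e hse)
  rcases hs₀e.eq_or_exists_last with rfl | ⟨e', hs₀e', he'e⟩
  · simpa [hN.linksBetween_self] using hshared _ hs₀ .refl
  have htwin : ∀ M ∈ N.pathLinkSets S R, e ∈ M ↔ e' ∈ M := by
    rintro _ ⟨s, hs, r, hr, -, rfl⟩
    simp only [mem_linksBetween, he'e]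
    constructor
    · rintro ⟨hse, her⟩
      obtain ⟨l, hl₀, hl⟩ := hshared s hs hse
      rw [← he'e] at hl₀ hl
      exact ⟨hN.reaches_tail_of_mem_linksBetween hs₀e' hl₀ hl, (reaches_tail_head e).trans her⟩
    · rintro ⟨hse', her⟩
      have hse : N.Reaches s (N.tail e) := he'e ▸ hse'.trans (reaches_tail_head e')
      exact ⟨hse, hescape s hs r hr hse her⟩
  obtain rfl := h.eq_of_forall_mem_iff htwin
  exact hN.not_reaches e' (he'e ▸ .refl)

-- A path from `N.tail e` becomes one from `s` by prepending the path from `s` to `N.tail e`.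
theorem IsForest.mem_or_union_mem_supClosure (hN : N.IsForest) {s : V} (hs : s ∈ S)
    (hse : N.Reaches s (N.tail e)) {X : Finset E}
    (hX : X ∈ supClosure (N.pathLinkSets (insert (N.tail e) (S ∩ U)) (R ∩ U))) :
    X ∈ supClosure (N.pathLinkSets S R) ∨
      N.linksBetween s (N.tail e) ∪ X ∈ supClosure (N.pathLinkSets S R) := by
  have hsup := supClosed_supClosure (s := N.pathLinkSets S R)
  refine supClosure_min (t := {X | X ∈ supClosure (N.pathLinkSets S R) ∨
      N.linksBetween s (N.tail e) ∪ X ∈ supClosure (N.pathLinkSets S R)}) ?_ ?_ hX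
  · rintro _ ⟨s', rfl | hs', r, hr, hs'r, rfl⟩
    · right
      rw [hN.linksBetween_union hse hs'r]
      exact subset_supClosure ⟨s, hs, r, hr.1, hse.trans hs'r, rfl⟩
    · exact .inl (subset_supClosure ⟨s', hs'.1, r, hr.1, hs'r, rfl⟩)
  · rintro X (hX | hX) Y (hY | hY)
    · exact .inl (hsup hX hY)
    · exact .inr (Finset.union_left_comm _ X Y ▸ hsup hX hY)
    · exact .inr (Finset.union_assoc _ X Y ▸ hsup hX hY)
    · exact .inr (Finset.union_union_distrib_left _ X Y ▸ hsup hX hY)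

theorem IsCut.disjoint_linksBetween (hU : N.IsCut e U) (hN : N.IsForest) {s r : V}
    (her : N.Reaches (N.tail e) r) (hnot : ¬ N.Reaches (N.head e) r) {X : Finset E}
    (hX : X ∈ supClosure (N.pathLinkSets (insert (N.tail e) (S ∩ U)) (R ∩ U))) :
    Disjoint X (N.linksBetween s r) := by
  have hrU : r ∉ U := fun h => hnot (hU.reaches_of_notMem_of_mem her hU.tail_notMem h).2
  have hXU : ∀ l ∈ X, N.head l ∈ U := by
    refine supClosure_min (t := {X | ∀ l ∈ X, N.head l ∈ U}) ?_ ?_ hX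
    · rintro _ ⟨s', hs', r', hr', -, rfl⟩ l hl
      exact hU.head_mem_of_mem_linksBetween hN (hs'.imp_right And.right) hr'.2 hl
    · exact fun X hX Y hY l hl => (Finset.mem_union.mp hl).elim (hX l) (hY l)
  exact Finset.disjoint_left.mpr fun l hlX hl =>
    hrU (hU.mem_of_reaches (mem_linksBetween.mp hl).2 (hXU l hlX))

theorem TailResolvable.prod_eq (h : N.TailResolvable S R e) (hN : N.IsForest)
    (hU : N.IsCut e U) {α α' : E → ℝ} (hα' : ∀ l, α' l ≠ 0)
    (hprod : ∀ M ∈ supClosure (N.pathLinkSets S R), ∏ l ∈ M, α l = ∏ l ∈ M, α' l) :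
    ∀ X ∈ supClosure (N.pathLinkSets (insert (N.tail e) (S ∩ U)) (R ∩ U)),
      ∏ l ∈ X, α l = ∏ l ∈ X, α' l := by
  intro X hX
  have hsup := supClosed_supClosure (s := N.pathLinkSets S R)
  rcases h with ⟨s, hs, s', hs', hse, hs'e, hdisj⟩ | ⟨s, hs, r, hr, hse, her, hnot⟩
  · rcases hN.mem_or_union_mem_supClosure hs hse hX with hmem | hmem
    · exact hprod X hmem
    rcases hN.mem_or_union_mem_supClosure hs' hs'e hX with hmem' | hmem'
    · exact hprod X hmem'
    have hinter := prod_inter_eq hα' (hprod _ hmem) (hprod _ hmem') (hprod _ (hsup hmem hmem'))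
    rwa [← Finset.inter_union_distrib_right, Finset.disjoint_iff_inter_eq_empty.mp hdisj,
      Finset.empty_union] at hinter
  · rcases hN.mem_or_union_mem_supClosure hs hse hX with hmem | hmem
    · exact hprod X hmem
    have hpath : N.linksBetween s r ∈ supClosure (N.pathLinkSets S R) :=
      subset_supClosure ⟨s, hs, r, hr, hse.trans her, rfl⟩
    have hunion : N.linksBetween s (N.tail e) ∪ X ∪ N.linksBetween s r =
        X ∪ N.linksBetween s r := by
      rw [← hN.linksBetween_union hse her]
      grind
    exact prod_eq_of_disjoint hα' (hU.disjoint_linksBetween hN her hnot hX) (hprod _ hpath)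
      (hunion ▸ hprod _ (hsup hmem hpath))

theorem determines_of_tailResolvable (hN : N.IsForest) (htail : N.TailResolvable S R e)
    (hhead : N.reverse.TailResolvable R S e) : Determines (N.pathLinkSets S R) e := by
  intro α α' _ hα' hprod
  replace hα' : ∀ l, α' l ≠ 0 := fun l => (hα' l).1.ne'
  obtain ⟨U, hU⟩ := hN e
  have hfrom := htail.prod_eq hN hU hα' hprod
  rw [← pathLinkSets_reverse] at hfrom
  have hlink := (hU.tailResolvable_reverse_inter hhead).prod_eq hN.reverse hU.compl hα' hfrom {e}
    (subset_supClosure ⟨N.head e, .inl rfl, N.tail e, ⟨.inl rfl, hU.tail_notMem⟩,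
      reaches_reverse.mpr (reaches_tail_head e),
      (linksBetween_reverse _ _).trans (hN.linksBetween_tail_head e)⟩)
  simpa only [Finset.prod_singleton] using hlink

theorem determines_iff (hN : N.IsForest) :
    Determines (N.pathLinkSets S R) e ↔
      N.TailResolvable S R e ∧ N.reverse.TailResolvable R S e :=
  ⟨fun h => ⟨tailResolvable_of_determines hN h,
    tailResolvable_of_determines hN.reverse (by rwa [pathLinkSets_reverse])⟩,
    fun h => determines_of_tailResolvable hN h.1 h.2⟩

end Multidigraph

section Law

variable {E : Type*} {𝓟 : Set (Finset E)} {W W' : E → Bool}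

/-- The indicator of the event that all links of `M` work, as a random variable on the states
`W : E → Bool` of the network. -/
def allWork (M : Finset E) : (E → Bool) → ℝ := fun W => if ∀ l ∈ M, W l then 1 else 0

theorem allWork_union [DecidableEq E] (M N : Finset E) :
    allWork (M ∪ N) = allWork M * allWork N := by
  ext W
  simp only [allWork, Finset.forall_mem_union, Pi.mul_apply, ite_and, ite_mul, one_mul, zero_mul]

theorem allWork_congr [DecidableEq E] (hW : ∀ M ∈ 𝓟, allWork M W = allWork M W') {M : Finset E}
    (hM : M ∈ supClosure 𝓟) : allWork M W = allWork M W' :=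
  supClosure_min (t := {M | allWork M W = allWork M W'}) hW
    (fun M hM N hN => by
      simp only [Set.mem_ofPred_eq, Finset.sup_eq_union, allWork_union, Pi.mul_apply] at hM hN ⊢
      rw [hM, hN]) hM

variable {X : Type*} [DecidableEq X] {f : (E → Bool) → X}

theorem indicator_mem_adjoin [Finite E]
    (hf : ∀ W W', f W = f W' ↔ ∀ M ∈ 𝓟, allWork M W = allWork M W') (W₀ : E → Bool) :
    (fun W => if f W = f W₀ then 1 else 0) ∈ Algebra.adjoin ℝ (allWork '' 𝓟) := by
  classical
  have hprod : (fun W => if f W = f W₀ then (1 : ℝ) else 0) =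
      ∏ M ∈ 𝓟.toFinite.toFinset, if ∀ l ∈ M, W₀ l then allWork M else 1 - allWork M := by
    ext W
    have hfactor (M : Finset E) :
        (if ∀ l ∈ M, W₀ l then allWork M else 1 - allWork M) W =
          if allWork M W = allWork M W₀ then 1 else 0 := by
      unfold allWork
      split_ifs <;> simp_all
    simp only [Finset.prod_apply, hfactor, Finset.prod_boole, Set.Finite.mem_toFinset, ← hf]
  rw [hprod]
  refine prod_mem fun M hM => ?_
  have hmem : allWork M ∈ Algebra.adjoin ℝ (allWork '' 𝓟) :=
    Algebra.subset_adjoin ⟨M, 𝓟.toFinite.mem_toFinset.mp hM, rfl⟩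
  split_ifs
  exacts [hmem, sub_mem (one_mem _) hmem]

variable [Fintype E] [DecidableEq E] {α α' : E → ℝ}

/-- The expectation of a function of the state of the network, when the links work independently,
link `l` with probability `α l`. -/
def expect (α : E → ℝ) : ((E → Bool) → ℝ) →ₗ[ℝ] ℝ :=
  Fintype.linearCombination ℝ fun W => ∏ l, if W l then α l else 1 - α l

theorem expect_apply (α : E → ℝ) (g : (E → Bool) → ℝ) :
    expect α g = ∑ W, g W * ∏ l, if W l then α l else 1 - α l := by
  simp [expect, Fintype.linearCombination_apply]

theorem expect_allWork (α : E → ℝ) (M : Finset E) : expect α (allWork M) = ∏ l ∈ M, α l := by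
  have hfactor (W : E → Bool) : (allWork M W * ∏ l, if W l then α l else 1 - α l) =
      ∏ l, if W l then α l else if l ∈ M then 0 else 1 - α l := by
    unfold allWork
    split_ifs with hW
    · rw [one_mul]
      exact Finset.prod_congr rfl fun l _ => by grind
    · push Not at hW
      obtain ⟨l, hl, hWl⟩ := hW
      rw [zero_mul, Finset.prod_eq_zero (Finset.mem_univ l) (by simp_all)]
  simp only [expect_apply, hfactor]
  rw [← Fintype.prod_sum fun l (b : Bool) => if b then α l else if l ∈ M then 0 else 1 - α l]
  simp [add_ite, Finset.prod_ite_mem]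

theorem expect_eq_of_mem_adjoin
    (hprod : ∀ M ∈ supClosure 𝓟, ∏ l ∈ M, α l = ∏ l ∈ M, α' l) {g : (E → Bool) → ℝ}
    (hg : g ∈ Algebra.adjoin ℝ (allWork '' 𝓟)) : expect α g = expect α' g := by
  have hmonoid : (Submonoid.closure (allWork '' 𝓟) : Set ((E → Bool) → ℝ)) ⊆
      allWork '' insert ∅ (supClosure 𝓟) := by
    intro g hg
    induction hg using Submonoid.closure_induction with
    | mem g hg => exact Set.image_mono (subset_supClosure.trans (Set.subset_insert _ _)) hg
    | one => exact ⟨∅, .inl rfl, by ext; simp [allWork]⟩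
    | mul _ _ _ _ hX hY =>
      obtain ⟨X, hX, rfl⟩ := hX
      obtain ⟨Y, hY, rfl⟩ := hY
      refine ⟨X ∪ Y, ?_, allWork_union X Y⟩
      rcases hX with rfl | hX
      · rwa [Finset.empty_union]
      rcases hY with rfl | hY
      · exact .inr (by rwa [Finset.union_empty])
      · exact .inr (supClosed_supClosure hX hY)
  have hspan : Submodule.span ℝ (Submonoid.closure (allWork '' 𝓟)) ≤
      LinearMap.eqLocus (expect α) (expect α') := by
    refine Submodule.span_le.mpr (hmonoid.trans ?_)
    rintro _ ⟨M, rfl | hM, rfl⟩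
    · simp [expect_allWork]
    · simpa [expect_allWork] using hprod M hM
  rw [← Subalgebra.mem_toSubmodule, Algebra.adjoin_eq_span] at hg
  exact hspan hg

theorem expect_eq_of_factorsThrough
    (hlaw : ∀ x, expect α (fun W => if f W = x then 1 else 0) =
      expect α' fun W => if f W = x then 1 else 0)
    {g : (E → Bool) → ℝ} (hg : g.FactorsThrough f) : expect α g = expect α' g := by
  have hsum : g = ∑ x ∈ Finset.univ.image f,
      Function.extend f g 0 x • fun W => if f W = x then 1 else 0 := by
    ext W
    simp [hg.extend_apply]
  rw [hsum]
  simp only [map_sum, map_smul, hlaw]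

theorem law_eq_iff (hf : ∀ W W', f W = f W' ↔ ∀ M ∈ 𝓟, allWork M W = allWork M W') :
    (∀ x, expect α (fun W => if f W = x then 1 else 0) =
      expect α' fun W => if f W = x then 1 else 0) ↔
      ∀ M ∈ supClosure 𝓟, ∏ l ∈ M, α l = ∏ l ∈ M, α' l := by
  refine ⟨fun hlaw M hM => ?_, fun hprod x => ?_⟩
  · rw [← expect_allWork, ← expect_allWork]
    exact expect_eq_of_factorsThrough hlaw fun W W' hW => allWork_congr ((hf W W').mp hW) hM
  · by_cases hx : ∃ W₀, f W₀ = x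
    · obtain ⟨W₀, rfl⟩ := hx
      exact expect_eq_of_mem_adjoin hprod (indicator_mem_adjoin hf W₀)
    · simp [not_exists.mp hx, expect_apply]

end Law

section Network

variable {V : Type*} {G : Digraph V}

/-- The network as a multigraph whose edges are the links. -/
def network (G : Digraph V) : Multidigraph V (Link G) := ⟨fun e => e.1.1, fun e => e.1.2⟩

theorem network_reaches {u v : V} : (network G).Reaches u v ↔ ReflTransGen G.Adj u v := by
  suffices (fun u v => ∃ e, (network G).tail e = u ∧ (network G).head e = v) = G.Adj by
    rw [Multidigraph.Reaches, this]
  ext u v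
  exact ⟨fun ⟨e, hu, hv⟩ => hu ▸ hv ▸ e.2, fun h => ⟨⟨(u, v), h⟩, rfl, rfl⟩⟩

theorem IsDirectedTree.adj_inclusive (hG : IsDirectedTree G) {u v : V} (huv : G.Adj u v) :
    G.toSimpleGraphInclusive.Adj u v :=
  ⟨by rintro rfl; exact hG.asymm _ _ huv huv, .inl huv⟩

theorem IsDirectedTree.isForest (hG : IsDirectedTree G) : (network G).IsForest := by
  rintro ⟨⟨C, D⟩, hCD⟩
  let T := G.toSimpleGraphInclusive.deleteEdges {s(C, D)}
  refine ⟨{v | T.Reachable D v}, fun h => ?_, SimpleGraph.Reachable.refl D, ?_⟩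
  · exact SimpleGraph.isAcyclic_iff_forall_adj_isBridge.mp hG.isTree.isAcyclic
      (hG.adj_inclusive hCD) h.symm
  · rintro ⟨⟨u, v⟩, huv⟩ hne
    have hadj : T.Adj u v := by
      refine SimpleGraph.deleteEdges_adj.mpr ⟨hG.adj_inclusive huv, fun h => ?_⟩
      rcases Sym2.eq_iff.mp h with ⟨rfl, rfl⟩ | ⟨rfl, rfl⟩
      exacts [hne rfl, hG.asymm _ _ hCD huv]
    exact ⟨fun h => h.trans hadj.reachable, fun h => h.trans hadj.symm.reachable⟩

theorem reaches_of_adj {u v : V} (huv : G.Adj u v) : (network G).Reaches u v :=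
  Multidigraph.reaches_tail_head (N := network G) ⟨(u, v), huv⟩

theorem IsDirectedTree.not_reaches_of_adj (hG : IsDirectedTree G) {u v : V} (huv : G.Adj u v) :
    ¬ (network G).Reaches v u :=
  hG.isForest.not_reaches ⟨(u, v), huv⟩

theorem IsDirectedTree.not_transGen_self (hG : IsDirectedTree G) (u : V) :
    ¬ TransGen G.Adj u u := fun h => by
  obtain ⟨v, huv, hvu⟩ := TransGen.head'_iff.mp h
  exact hG.not_reaches_of_adj huv (network_reaches.mpr hvu)

namespace IsDiPath

variable {u v w : V} {p : List V}

theorem of_cons_cons {x : V} (h : IsDiPath G u v (x :: w :: p)) :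
    x = u ∧ G.Adj u w ∧ IsDiPath G w v (w :: p) := by
  obtain ⟨hchain, hnodup, hhead, hlast⟩ := h
  obtain rfl : x = u := by simpa using hhead
  obtain ⟨hxw, hchain⟩ := List.isChain_cons_cons.mp hchain
  exact ⟨rfl, hxw, hchain, hnodup.of_cons, rfl, by rwa [List.getLast?_cons_cons] at hlast⟩

theorem reaches (h : IsDiPath G u v p) : (network G).Reaches u v := by
  rw [network_reaches]
  obtain ⟨hchain, -, hhead, hlast⟩ := h
  obtain ⟨p, rfl⟩ := List.head?_eq_some_iff.mp hhead
  refine List.relationReflTransGen_of_exists_isChain_cons p hchain ?_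
  rwa [List.getLast?_eq_getLast_of_ne_nil (List.cons_ne_nil u p), Option.some_inj] at hlast

end IsDiPath

theorem IsDirectedTree.exists_isDiPath_iff (hG : IsDirectedTree G) {u v : V} :
    (∃ p, IsDiPath G u v p) ↔ (network G).Reaches u v := by
  refine ⟨fun ⟨p, hp⟩ => hp.reaches, fun h => ?_⟩
  obtain ⟨p, hchain, hlast⟩ :=
    List.exists_isChain_cons_of_relationReflTransGen (network_reaches.mp h)
  have hpairwise : (u :: p).Pairwise (TransGen G.Adj) :=
    (hchain.imp fun _ _ => TransGen.single).pairwise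
  have hnodup : (u :: p).Nodup := hpairwise.imp fun hxy => by
    rintro rfl
    exact hG.not_transGen_self _ hxy
  exact ⟨u :: p, hchain, hnodup, rfl, by
    rw [List.getLast?_eq_getLast_of_ne_nil (List.cons_ne_nil u p), hlast]⟩

theorem IsDiPath.mem_pathLinks_iff [Fintype V] [DecidableRel G.Adj] {u v : V} {p : List V}
    (h : IsDiPath G u v p) (hG : IsDirectedTree G) {x : V × V} :
    x ∈ pathLinks p ↔ ∃ e ∈ (network G).linksBetween u v, e.1 = x := by
  classical
  induction p generalizing u with
  | nil => simpa using h.head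
  | cons y p ih =>
    cases p with
    | nil =>
      obtain rfl : y = u := by simpa using h.head
      obtain rfl : y = v := by simpa using h.last
      simp [pathLinks, hG.isForest.linksBetween_self]
    | cons w p =>
      obtain ⟨rfl, hyw, hp⟩ := h.of_cons_cons
      have hinsert : insert ⟨(y, w), hyw⟩ ((network G).linksBetween w v) =
          (network G).linksBetween y v :=
        Multidigraph.IsForest.insert_linksBetween_head (N := network G) (e := ⟨(y, w), hyw⟩)
          hG.isForest hp.reaches
      change x ∈ (y, w) :: pathLinks (w :: p) ↔ _
      rw [List.mem_cons, ih hp, ← hinsert, Finset.exists_mem_insert, eq_comm]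

theorem IsDiPath.link_mem_pathLinks_iff [Finite V] {u v : V} {p : List V} (h : IsDiPath G u v p)
    (hG : IsDirectedTree G) (e : Link G) :
    e.1 ∈ pathLinks p ↔ (network G).Reaches u e.1.1 ∧ (network G).Reaches e.1.2 v := by
  classical
  cases nonempty_fintype V
  rw [h.mem_pathLinks_iff hG]
  refine Iff.trans ?_ Multidigraph.mem_linksBetween
  exact ⟨fun ⟨e', he', heq⟩ => Subtype.ext heq ▸ he', fun he => ⟨e, he, rfl⟩⟩

variable [Fintype V] [DecidableRel G.Adj] {S R : Finset V}

theorem IsDiPath.disjoint_pathLinks_iff {u v u' v' : V} {p p' : List V} (h : IsDiPath G u v p)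
    (h' : IsDiPath G u' v' p') (hG : IsDirectedTree G) :
    (pathLinks p).Disjoint (pathLinks p') ↔
      Disjoint ((network G).linksBetween u v) ((network G).linksBetween u' v') := by
  simp only [List.Disjoint, Finset.disjoint_left, h.mem_pathLinks_iff hG, h'.mem_pathLinks_iff hG]
  constructor
  · exact fun hdisj e he he' => hdisj ⟨e, he, rfl⟩ ⟨e, he', rfl⟩
  · rintro hdisj _ ⟨e, he, rfl⟩ ⟨e', he', heq⟩
    exact hdisj he (Subtype.ext heq ▸ he')

theorem tailCondition_iff (hG : IsDirectedTree G) {C D : V} (hCD : G.Adj C D) :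
    TailCondition G S R C D ↔ (network G).TailResolvable S R ⟨(C, D), hCD⟩ := by
  let e : Link G := ⟨(C, D), hCD⟩
  have hDC : ¬ (network G).Reaches D C := hG.not_reaches_of_adj hCD
  rw [hG.isForest.tailResolvable_iff]
  refine or_congr Iff.rfl (or_congr ?_ ?_)
  · constructor
    · rintro ⟨s, hs, s', hs', hne, p, p', hp, hp', hdisj, -, -⟩
      exact ⟨s, hs, s', hs', hne, hp.reaches, hp'.reaches,
        (hp.disjoint_pathLinks_iff hp' hG).mp hdisj⟩
    · rintro ⟨s, hs, s', hs', hne, hsC, hs'C, hdisj⟩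
      obtain ⟨p, hp⟩ := hG.exists_isDiPath_iff.mpr hsC
      obtain ⟨p', hp'⟩ := hG.exists_isDiPath_iff.mpr hs'C
      exact ⟨s, hs, s', hs', hne, p, p', hp, hp', (hp.disjoint_pathLinks_iff hp' hG).mpr hdisj,
        fun h => hDC ((hp.link_mem_pathLinks_iff hG e).mp h).2,
        fun h => hDC ((hp'.link_mem_pathLinks_iff hG e).mp h).2⟩
  · constructor
    · rintro ⟨s, hs, r, hr, p, q, hp, hq, -, hnot⟩
      exact ⟨s, hs, r, hr, hp.reaches, hq.reaches,
        fun h => hnot ((hq.link_mem_pathLinks_iff hG e).mpr ⟨.refl, h⟩)⟩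
    · rintro ⟨s, hs, r, hr, hsC, hCr, hnot⟩
      obtain ⟨p, hp⟩ := hG.exists_isDiPath_iff.mpr hsC
      obtain ⟨q, hq⟩ := hG.exists_isDiPath_iff.mpr hCr
      exact ⟨s, hs, r, hr, p, q, hp, hq,
        fun h => hDC ((hp.link_mem_pathLinks_iff hG e).mp h).2,
        fun h => hnot ((hq.link_mem_pathLinks_iff hG e).mp h).2⟩

theorem headCondition_iff (hG : IsDirectedTree G) {C D : V} (hCD : G.Adj C D) :
    HeadCondition G S R C D ↔ (network G).reverse.TailResolvable R S ⟨(C, D), hCD⟩ := by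
  let e : Link G := ⟨(C, D), hCD⟩
  have hDC : ¬ (network G).Reaches D C := hG.not_reaches_of_adj hCD
  rw [hG.isForest.reverse.tailResolvable_iff]
  simp only [Multidigraph.reaches_reverse, Multidigraph.linksBetween_reverse]
  refine or_congr Iff.rfl (or_congr ?_ ?_)
  · constructor
    · rintro ⟨r, hr, r', hr', hne, q, q', hq, hq', hdisj, -, -⟩
      exact ⟨r, hr, r', hr', hne, hq.reaches, hq'.reaches,
        (hq.disjoint_pathLinks_iff hq' hG).mp hdisj⟩
    · rintro ⟨r, hr, r', hr', hne, hDr, hDr', hdisj⟩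
      obtain ⟨q, hq⟩ := hG.exists_isDiPath_iff.mpr hDr
      obtain ⟨q', hq'⟩ := hG.exists_isDiPath_iff.mpr hDr'
      exact ⟨r, hr, r', hr', hne, q, q', hq, hq', (hq.disjoint_pathLinks_iff hq' hG).mpr hdisj,
        fun h => hDC ((hq.link_mem_pathLinks_iff hG e).mp h).1,
        fun h => hDC ((hq'.link_mem_pathLinks_iff hG e).mp h).1⟩
  · constructor
    · rintro ⟨s, hs, r, hr, p, q, hp, hq, hnot, -⟩
      exact ⟨r, hr, s, hs, hq.reaches, hp.reaches,
        fun h => hnot ((hp.link_mem_pathLinks_iff hG e).mpr ⟨h, .refl⟩)⟩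
    · rintro ⟨r, hr, s, hs, hDr, hsD, hnot⟩
      obtain ⟨p, hp⟩ := hG.exists_isDiPath_iff.mpr hsD
      obtain ⟨q, hq⟩ := hG.exists_isDiPath_iff.mpr hDr
      exact ⟨s, hs, r, hr, p, q, hp, hq,
        fun h => hnot ((hp.link_mem_pathLinks_iff hG e).mp h).1,
        fun h => hDC ((hq.link_mem_pathLinks_iff hG e).mp h).1⟩

end Network

section Packet

variable {V F : Type*} [Fintype V] [DecidableEq V] [Field F] {G : Digraph V} [DecidableRel G.Adj]
  {S R : Finset V} {c : V → V → F}

theorem packet_eq_zero (hG : IsDirectedTree G) (W : Link G → Bool) {v : V} {i : S}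
    (h : ¬ (network G).Reaches i v) : packet G hG S c W v i = 0 := by
  induction v using hG.wellFounded.induction with
  | _ v ih =>
    have hne : (i : V) ≠ v := fun hiv => h (hiv ▸ .refl)
    rw [packet_eq, if_neg hne, zero_add]
    refine Finset.sum_eq_zero fun u _ => ?_
    have hu : ¬ (network G).Reaches i u := fun hu =>
      h (hu.trans (reaches_of_adj u.2))
    rw [ih u u.2 hu, mul_zero, ite_self]

theorem packet_self (hG : IsDirectedTree G) (W : Link G → Bool) (i : S) :
    packet G hG S c W i i = 1 := by
  rw [packet_eq, if_pos rfl, add_eq_left]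
  refine Finset.sum_eq_zero fun u _ => ?_
  rw [packet_eq_zero hG W (hG.not_reaches_of_adj u.2), mul_zero, ite_self]

theorem packet_of_adj (hG : IsDirectedTree G) (W : Link G → Bool) {i : S} {u v : V}
    (hiu : (network G).Reaches i u) (huv : G.Adj u v) :
    packet G hG S c W v i = if W ⟨(u, v), huv⟩ then c u v * packet G hG S c W u i else 0 := by
  have hne : (i : V) ≠ v := by
    rintro rfl
    exact hG.not_reaches_of_adj huv hiu
  have hother (u' : {u' : V // G.Adj u' v}) (hu' : u' ≠ ⟨u, huv⟩) : ¬ (network G).Reaches i u' := by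
    intro hiu'
    have heq := Multidigraph.IsForest.eq_of_head_eq (N := network G) (e := ⟨(u, v), huv⟩)
      (e' := ⟨(u', v), u'.2⟩) hG.isForest hiu hiu' rfl
    exact hu' (Subtype.ext (congrArg (fun e : Link G => e.1.1) heq))
  rw [packet_eq, if_neg hne, zero_add, Fintype.sum_eq_single ⟨u, huv⟩]
  intro u' hu'
  rw [packet_eq_zero hG W (hother u' hu'), mul_zero, ite_self]

theorem exists_packet_eq_ite (hG : IsDirectedTree G) (hc : ∀ u v : V, G.Adj u v → c u v ≠ 0)
    {i : S} {v : V} (h : (network G).Reaches i v) :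
    ∃ k : F, k ≠ 0 ∧ ∀ W : Link G → Bool, packet G hG S c W v i =
      if ∀ e ∈ (network G).linksBetween i v, W e then k else 0 := by
  rw [network_reaches] at h
  induction h with
  | refl => exact ⟨1, one_ne_zero, by simp [packet_self, hG.isForest.linksBetween_self]⟩
  | @tail u v hiu huv ih =>
    rw [← network_reaches] at hiu
    obtain ⟨k, hk, hpacket⟩ := ih
    have hinsert : insert ⟨(u, v), huv⟩ ((network G).linksBetween i u) =
        (network G).linksBetween i v :=
      Multidigraph.IsForest.insert_linksBetween_tail (N := network G) (e := ⟨(u, v), huv⟩)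
        hG.isForest hiu
    refine ⟨c u v * k, mul_ne_zero (hc _ _ huv) hk, fun W => ?_⟩
    rw [packet_of_adj hG W hiu huv, hpacket, ← hinsert]
    simp only [Finset.forall_mem_insert, ite_and, mul_ite, mul_zero]

theorem observation_eq_iff (hG : IsDirectedTree G) (hc : ∀ u v : V, G.Adj u v → c u v ≠ 0)
    (W W' : Link G → Bool) :
    observation G hG S R c W = observation G hG S R c W' ↔
      ∀ M ∈ (network G).pathLinkSets S R, allWork M W = allWork M W' := by
  have hpacket (i : S) (v : V) (h : (network G).Reaches i v) :
      packet G hG S c W v i = packet G hG S c W' v i ↔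
        allWork ((network G).linksBetween i v) W = allWork ((network G).linksBetween i v) W' := by
    obtain ⟨k, hk, hpacket⟩ := exists_packet_eq_ite hG hc h
    rw [hpacket, hpacket, allWork, allWork]
    split_ifs <;> simp [hk, hk.symm]
  constructor
  · rintro hobs _ ⟨s, hs, r, hr, hsr, rfl⟩
    exact (hpacket ⟨s, hs⟩ r hsr).mp (congrFun (congrFun hobs ⟨r, hr⟩) ⟨s, hs⟩)
  · intro hwork
    funext r s
    by_cases hsr : (network G).Reaches s r
    · exact (hpacket s r hsr).mpr (hwork _ ⟨s, s.2, r, r.2, hsr, rfl⟩)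
    · exact (packet_eq_zero hG W hsr).trans (packet_eq_zero hG W' hsr).symm

theorem isIdentifiable_iff [DecidableEq F] (hG : IsDirectedTree G)
    (hc : ∀ u v : V, G.Adj u v → c u v ≠ 0) (e : Link G) :
    IsIdentifiable G hG S R c e ↔ Determines ((network G).pathLinkSets S R) e := by
  have hobsProb (α : Link G → ℝ) (x : R → S → F) : obsProb G hG S R c α x =
      expect α fun W => if observation G hG S R c W = x then 1 else 0 := by
    simp only [obsProb, stateProb, expect_apply, ite_mul, one_mul, zero_mul]
  refine forall₂_congr fun α α' => forall₂_congr fun _ _ => imp_congr_left ?_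
  rw [funext_iff]
  simp only [hobsProb]
  exact law_eq_iff (observation_eq_iff hG hc)

end Packet

end LossTomography

theorem theorem1 {V F : Type*} [Fintype V] [DecidableEq V] [Field F] [DecidableEq F]
    (G : Digraph V) [DecidableRel G.Adj] (hG : LossTomography.IsDirectedTree G)
    (S R : Finset V) (c : V → V → F) (hc : ∀ u v : V, G.Adj u v → c u v ≠ 0)
    (C D : V) (hCD : G.Adj C D) :
    LossTomography.IsIdentifiable G hG S R c ⟨(C, D), hCD⟩ ↔
      LossTomography.TailCondition G S R C D ∧ LossTomography.HeadCondition G S R C D := by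
  rw [LossTomography.isIdentifiable_iff hG hc,
    LossTomography.Multidigraph.determines_iff hG.isForest,
    LossTomography.tailCondition_iff hG hCD, LossTomography.headCondition_iff hG hCD]
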